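/- Let $\mathbb{T}\subseteq\mathbb{R}$ be a nontrivial divisible additive subgroup (the value group of an algebraically closed field with a nontrivial rank one valuation), with tropical operations $\max$ and $+$. Let $I\subset\mathbb{Z}^2$ be a nonempty finite set with $\delta$ elements, and let $f(p)=\max_{i\in I}(a_i+i\cdot p)$, $a_i\in\mathbb{T}$, be a tropical polynomial of support $I$. Its tropical curve $C=\mathcal{T}(f)$ is the set of points $p\in\mathbb{T}^2$ at which the maximum is attained for at least two indices. For $p\in\mathbb{R}^2$ let $\Delta_p$ be the convex hull of the indices $i\in I$ at which the maximum defining $f(p)$ is attained; the sets $\Delta_p$ are the cells of the subdivision of the Newton polygon $\mathrm{conv}(I)$ dual to $C$. A point $q\in C$ lies in (the relative interior of) an edge of $C$ if $\dim\Delta_q=1$, and is a vertex of $C$ if $\dim\Delta_q=2$. A tropical curve is considered together with its dual subdivision: two polynomials of support $I$ define the same curve if they define the same subset of $\mathbb{T}^2$ and have the same dual cell $\Delta_p$ at every $p\in\mathbb{R}^2$. Let $\Gamma$ be the graph with vertex set $I$ whose edges are the segments into which the points of $I$ cut the one-dimensional cells of the dual subdivision (so that the points of $I$ interior to a polygon of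 the subdivision are isolated in $\Gamma$). An assignment of points $q_1,\dots,q_n$ (possibly repeated) of $C$ is a choice, for each $q_j$, of - an edge of $\Gamma$ contained in $\Delta_{q_j}$, if $q_j$ lies in an edge of $C$; - either a point of $I$ in the interior of $\Delta_{q_j}$ or an edge of $\Gamma$ contained in the boundary of $\Delta_{q_j}$, if $q_j$ is a vertex of $C$; such that no point of $I$ and no edge of $\Gamma$ is assigned to two different indices $j$, and the assigned edges form an acyclic subgraph of $\Gamma$. The stable curve of support $I$ through $q_1,\dots,q_{\delta-1}\in\mathbb{T}^2$ is the curve of the polynomial of support $I$ given by the tropical Cramer rule: its coefficient at $i\in I$ is $\max_\sigma\sum_{j=1}^{\delta-1}\sigma(j)\cdot q_j$, where $\sigma$ runs over the bijections $\{1,\dots,\delta-1\}\to I\setminus\{i\}$. Points $q_1,\dots,q_n$, $n\le\delta-1$, are in general position in $C$ if they can be completed to points $q_1,\dots,q_{\delta-1}$ of $\mathbb{T}^2$ such that $C$ is the stable curve of support $I$ through them. **Theorem.** Let $q_1,\dots,q_{\delta-1}$ be points of $C$. If there is an assignment of $q_1,\dots,q_{\delta-1}$, then $C$ is the stable curve of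 support $I$ through $q_1,\dots,q_{\delta-1}$. In particular, $q_1,\dots,q_{\delta-1}$ are in general position in $C$. -/

import Mathlib

namespace TropPlane

/-- The tropical determinant (max-plus) of a square matrix: the maximum over all bijections `σ`
from rows to columns of `∑ i, A i (σ i)`. Rows and columns may carry different index types. -/
def tropDet {R m n : Type*} [LinearOrder R] [AddCommMonoid R] [Fintype m] [Fintype n]
    [DecidableEq m] [DecidableEq n] [Nonempty (m ≃ n)] (A : Matrix m n R) : R :=
  Finset.univ.sup' Finset.univ_nonempty fun σ : m ≃ n => ∑ i, A i (σ i)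

instance nonempty_equiv_ne (I : Finset (ℤ × ℤ)) (i : I) :
    Nonempty (Fin (I.card - 1) ≃ {k : I // k ≠ i}) := by
  apply Fintype.card_eq.mp
  rw [Fintype.card_fin, Fintype.card_subtype_compl, Fintype.card_subtype_eq, Fintype.card_coe]

/-- An exponent vector, regarded as a point of the real plane. -/
def realPt (i : ℤ × ℤ) : ℝ × ℝ := ((i.1 : ℝ), (i.2 : ℝ))

/-- A tropical point, regarded as a point of the real plane. -/
def toReal {T : AddSubgroup ℝ} (q : T × T) : ℝ × ℝ := ((q.1 : ℝ), (q.2 : ℝ))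

variable {T : AddSubgroup ℝ} {I : Finset (ℤ × ℤ)}

/-- The value at `p` of the tropical monomial of exponent `i` in the tropical polynomial of support
`I` with coefficients `a`, that is, `a i + i₁ p₁ + i₂ p₂`. -/
def monomialValue (a : I → T) (i : I) (p : ℝ × ℝ) : ℝ :=
  (a i : ℝ) + (i.1.1 : ℝ) * p.1 + (i.1.2 : ℝ) * p.2

/-- The tropical curve of the tropical polynomial of support `I` with coefficients `a`: the points
of `T²` at which the maximum of the monomials is attained for two different indices. -/
def curve (a : I → T) : Set (T × T) :=
  {q | ∃ i j : I, i ≠ j ∧ monomialValue a i (toReal q) = monomialValue a j (toReal q) ∧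
    ∀ k : I, monomialValue a k (toReal q) ≤ monomialValue a i (toReal q)}

/-- The indices of `I` at which the maximum of the monomials is attained at `p`. -/
def maxIndices (a : I → T) (p : ℝ × ℝ) : Set I :=
  {i | ∀ k : I, monomialValue a k p ≤ monomialValue a i p}

/-- The cell of the dual (regular) subdivision of the Newton polygon corresponding to `p`: the
projection of the face of the upper hull of `{(i, t) | t ≤ a i}` that maximizes the linear
functional `(p, 1)`. It is a vertex, an edge or a polygon according to whether `p` lies in the
complement, in the relative interior of an edge, or at a vertex of the curve. -/
def dualCell (a : I → T) (p : ℝ × ℝ) : Set (ℝ × ℝ) :=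
  convexHull ℝ ((fun i : I => realPt i) '' maxIndices a p)

/-- The cells of the dual subdivision of the Newton polygon. -/
def subdivision (a : I → T) : Set (Set (ℝ × ℝ)) :=
  Set.range (dualCell a)

/-- The dimension of a cell. -/
noncomputable def cellDim (s : Set (ℝ × ℝ)) : ℕ :=
  Module.finrank ℝ (vectorSpan ℝ s)

/-- The refined graph `Γ`: its vertices are all the points of `I`, and its edges are the pieces into
which the points of `I` cut the one-dimensional cells of the dual subdivision. The points of `I`
in the interior of a polygon of the subdivision are isolated. -/
def refinedGraph (a : I → T) : SimpleGraph I where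
  Adj x y := x ≠ y ∧
    (∃ s ∈ subdivision a, cellDim s = 1 ∧ realPt x ∈ s ∧ realPt y ∈ s) ∧
    ∀ z : I, realPt z ∉ openSegment ℝ (realPt x) (realPt y)
  symm := ⟨by
    rintro x y ⟨hxy, ⟨s, hs, hd, hx, hy⟩, hz⟩
    refine ⟨hxy.symm, ⟨s, hs, hd, hy, hx⟩, fun z => ?_⟩
    rw [openSegment_symm]
    exact hz z⟩
  loopless := ⟨fun _ h => h.1 rfl⟩

/-- The admissible individual assignments of a point `q` of the curve, either a point of `I`
(`Sum.inl`) or an edge of `Γ` (`Sum.inr`). -/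
inductive IsAssignable (a : I → T) (q : T × T) : I ⊕ Sym2 I → Prop
  /-- `q` lies in an edge of the curve: a refined edge contained in the dual edge. -/
  | edge (x y : I) (hdim : cellDim (dualCell a (toReal q)) = 1)
      (hadj : (refinedGraph a).Adj x y)
      (hsub : segment ℝ (realPt x) (realPt y) ⊆ dualCell a (toReal q)) :
      IsAssignable a q (Sum.inr s(x, y))
  /-- `q` is a vertex of the curve: a point of `I` in the interior of the dual polygon. -/
  | vertexPoint (x : I) (hdim : cellDim (dualCell a (toReal q)) = 2)
      (hx : realPt x ∈ interior (dualCell a (toReal q))) :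
      IsAssignable a q (Sum.inl x)
  /-- `q` is a vertex of the curve: a refined edge in the boundary of the dual polygon. -/
  | vertexEdge (x y : I) (hdim : cellDim (dualCell a (toReal q)) = 2)
      (hadj : (refinedGraph a).Adj x y)
      (hsub : segment ℝ (realPt x) (realPt y) ⊆ frontier (dualCell a (toReal q))) :
      IsAssignable a q (Sum.inr s(x, y))

/-- An assignment of the (possibly repeated) points `q₁, …, qₙ`: each point is assigned to one of
its admissible targets, nothing is assigned twice, and the assigned edges form an acyclic graph. -/
structure IsAssignment (a : I → T) {n : ℕ} (q : Fin n → T × T)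
    (α : Fin n → I ⊕ Sym2 I) : Prop where
  assignable : ∀ j, IsAssignable a (q j) (α j)
  injective : Function.Injective α
  acyclic : (SimpleGraph.fromEdgeSet {e : Sym2 I | ∃ j, α j = Sum.inr e}).IsAcyclic

/-- The matrix of the tropical linear system on the coefficients of a polynomial of support `I`
that expresses passing through the points `q`: its `(j, i)` entry is the value of the monomial
of exponent `i` at the point `q j`. -/
def pointMatrix (I : Finset (ℤ × ℤ)) {n : ℕ} (q : Fin n → T × T) : Matrix (Fin n) I T :=
  fun j i => i.1.1 • (q j).1 + i.1.2 • (q j).2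

/-- The coefficients of the stable curve of support `I` through `δ - 1` points, by the tropical
Cramer rule: the `i`-th coefficient is the tropical determinant of the matrix of the system with
the `i`-th column deleted. -/
noncomputable def stableCoeff (I : Finset (ℤ × ℤ)) (q : Fin (I.card - 1) → T × T) : I → T :=
  fun i => tropDet ((pointMatrix I q).submatrix id (fun k : {k : I // k ≠ i} => (k : I)))

/-- Two tropical polynomials of support `I` define the same tropical curve: the same set of points,
with the same dual cells (so also the same dual subdivision and the same edge weights). -/
def SameCurve (a b : I → T) : Prop :=
  curve a = curve b ∧ ∀ p : ℝ × ℝ, dualCell a p = dualCell b p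

/-- The curve defined by `a` is the stable curve of support `I` through the points `q`. -/
def IsStableCurve (a : I → T) (q : Fin (I.card - 1) → T × T) : Prop :=
  SameCurve a (stableCoeff I q)

/-- The points `q₁, …, qₙ`, `n ≤ δ - 1`, are in general position in the curve defined by `a`: they
can be completed to `δ - 1` points through which it is the stable curve of support `I`. -/
def InGeneralPosition (a : I → T) {n : ℕ} (q : Fin n → T × T) : Prop :=
  ∃ (h : n ≤ I.card - 1) (Q : Fin (I.card - 1) → T × T),
    (∀ j : Fin n, Q (Fin.castLE h j) = q j) ∧ IsStableCurve a Q

end TropPlane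

/-!
Let `f` be the tropical polynomial with coefficients `a`, let `h i = inf_p (f p - i · p)` be the
height over `i` of the upper hull of the lifted points `(i, a i)`, and let `b` be the vector of
Cramer coefficients. Then `a i ≤ h i ≤ f p - i · p`, and the second inequality is an equality
exactly when `i` lies in the dual cell of `p` (`upperHull_eq_iff`).

For a bijection `σ` onto `I \ {i}`, summing `σ j · q j ≤ f (q j) - h (σ j)` over `j` gives
`b i ≤ h i + C`, where `C = ∑ j, f (q j) - ∑ k, h k` does not depend on `i`. Equality holds as soon
as some `σ` sends every `j` into the dual cell of `q j`. Such a `σ` comes from the assignment: a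
point goes to the point of `I` assigned to it, or to an end of the edge assigned to it. Hall's
theorem provides an injective choice that avoids `i`, because a nonempty acyclic graph has more
vertices than edges (`exists_injective_avoiding`). This needs `i` not to be itself an assigned
point, and assigned points not to be ends of assigned edges.

A point of `I` in the interior of a dual polygon lies in no other dual cell (`eq_of_mem_interior`).
So it is neither an end of an edge of `Γ` nor an extreme point of a dual cell. The first property
supplies the disjointness used above, and the second shows that `b` and `h + C` agree at all extreme
points of dual cells. Since `b ≤ h + C` everywhere, this determines all the dual cells of `b`
(`dualCell_eq_of_le_upperHull`), and the curve is read off from the dual cells.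
-/

/-! ### Transversals of acyclic graphs -/

/-- An acyclic set of edges, all of whose ends lie in a nonempty set `s`, has fewer than `|s|`
elements. -/
theorem SimpleGraph.IsAcyclic.card_lt_of_forall_mem {V : Type*} [DecidableEq V]
    {E : Finset (Sym2 V)} (hdiag : ∀ e ∈ E, ¬ e.IsDiag)
    (hE : (SimpleGraph.fromEdgeSet (E : Set (Sym2 V))).IsAcyclic)
    {s : Finset V} (hs : s.Nonempty) (hEs : ∀ e ∈ E, ∀ v ∈ e, v ∈ s) : E.card < s.card := by
  classical
  have : Nonempty s := hs.to_subtype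
  -- Extend the restriction of the graph to `s` to a tree on `s`, whose edges can be counted.
  obtain ⟨F, hF, hmax⟩ := Finite.exists_le_maximal
    (p := fun H : SimpleGraph s => H.IsAcyclic) (hE.induce (s : Set V))
  have hcard := (SimpleGraph.maximal_isAcyclic_iff_isTree.mp hmax).card_edgeFinset
  have hsub : E ⊆ F.edgeFinset.image (Sym2.map Subtype.val) := by
    intro e he
    induction e using Sym2.ind with
    | _ x y =>
      have hx : x ∈ s := hEs _ he x (by simp)
      have hy : y ∈ s := hEs _ he y (by simp)
      refine Finset.mem_image.mpr ⟨s(⟨x, hx⟩, ⟨y, hy⟩), ?_, rfl⟩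
      rw [SimpleGraph.mem_edgeFinset, SimpleGraph.mem_edgeSet]
      apply hF
      have hxy : x ≠ y := by simpa using hdiag _ he
      simpa [SimpleGraph.fromEdgeSet_adj] using ⟨he, hxy⟩
  have h := (Finset.card_le_card hsub).trans Finset.card_image_le
  rw [Fintype.card_coe] at hcard
  omega

namespace TropPlane

/-- The points of `I` to which an assigned object can be matched: the point itself, or the ends of
the edge. -/
def targetPoints {V : Type*} [DecidableEq V] : V ⊕ Sym2 V → Finset V :=
  Sum.elim (fun x => {x}) Sym2.toFinset

/-- Distinct points and edges, such that the edges form an acyclic graph disjoint from the points,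
can be represented by distinct vertices, all different from a given vertex `i` that is not one of
the points. -/
theorem exists_injective_avoiding {ι V : Type*} [Finite ι] [DecidableEq V] {α : ι → V ⊕ Sym2 V}
    (hα : Function.Injective α) (hdiag : ∀ j e, α j = Sum.inr e → ¬ e.IsDiag)
    (hacyc : (SimpleGraph.fromEdgeSet {e : Sym2 V | ∃ j, α j = Sum.inr e}).IsAcyclic)
    (hdisj : ∀ j k x e, α j = Sum.inl x → α k = Sum.inr e → x ∉ e)
    {i : V} (hi : ∀ j, α j ≠ Sum.inl i) :
    ∃ f : ι → V, Function.Injective f ∧ ∀ j, f j ∈ targetPoints (α j) ∧ f j ≠ i := by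
  classical
  suffices h : ∃ f : ι → V, Function.Injective f ∧ ∀ j, f j ∈ (targetPoints (α j)).erase i by
    obtain ⟨f, hf, hmem⟩ := h
    exact ⟨f, hf, fun j => (Finset.mem_erase.mp (hmem j)).symm⟩
  rw [← Finset.all_card_le_biUnion_card_iff_existsInjective']
  intro s
  -- `L` and `R` are the points and the edges indexed by `s`, and `W` consists of the ends of the
  -- edges in `R`.
  set L : Finset V := (s.image α).toLeft with hL
  set R : Finset (Sym2 V) := (s.image α).toRight with hR
  set W : Finset V := R.biUnion Sym2.toFinset with hW
  have hmemL : ∀ x, x ∈ L ↔ ∃ j ∈ s, α j = Sum.inl x := by simp [hL]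
  have hmemR : ∀ e, e ∈ R ↔ ∃ j ∈ s, α j = Sum.inr e := by simp [hR]
  have hs : s.card = L.card + R.card := by
    rw [← Finset.card_image_of_injective s hα, hL, hR, Finset.card_toLeft_add_card_toRight]
  have hRW : R.card ≤ (W.erase i).card := by
    rcases R.eq_empty_or_nonempty with h0 | ⟨e, he⟩
    · simp [h0]
    · have hWne : W.Nonempty := by
        obtain ⟨v, hv⟩ := Finset.nonempty_iff_ne_empty.mpr (Sym2.toFinset_ne_empty e)
        exact ⟨v, Finset.mem_biUnion.mpr ⟨e, he, hv⟩⟩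
      have hlt : R.card < W.card := by
        refine SimpleGraph.IsAcyclic.card_lt_of_forall_mem ?_ ?_ hWne ?_
        · intro e he
          obtain ⟨j, -, hj⟩ := (hmemR e).mp he
          exact hdiag j e hj
        · refine hacyc.anti (SimpleGraph.fromEdgeSet_mono fun e he => ?_)
          obtain ⟨j, -, hj⟩ := (hmemR e).mp he
          exact ⟨j, hj⟩
        · intro e he v hv
          exact Finset.mem_biUnion.mpr ⟨e, he, Sym2.mem_toFinset.mpr hv⟩
      have := Finset.pred_card_le_card_erase (s := W) (a := i)
      omega
  have hLW : Disjoint L (W.erase i) := by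
    rw [Finset.disjoint_left]
    intro x hx hx'
    obtain ⟨j, -, hj⟩ := (hmemL x).mp hx
    obtain ⟨e, he, hxe⟩ := Finset.mem_biUnion.mp (Finset.mem_of_mem_erase hx')
    obtain ⟨k, -, hk⟩ := (hmemR e).mp he
    exact hdisj j k x e hj hk (Sym2.mem_toFinset.mp hxe)
  rw [hs]
  refine (Nat.add_le_add_left hRW _).trans ?_
  rw [← Finset.card_union_of_disjoint hLW]
  refine Finset.card_le_card (Finset.union_subset ?_ ?_)
  · intro x hx
    obtain ⟨j, hjs, hj⟩ := (hmemL x).mp hx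
    refine Finset.mem_biUnion.mpr ⟨j, hjs, Finset.mem_erase.mpr ⟨?_, by simp [hj, targetPoints]⟩⟩
    rintro rfl
    exact hi j hj
  · intro x hx
    obtain ⟨hxi, hx⟩ := Finset.mem_erase.mp hx
    obtain ⟨e, he, hxe⟩ := Finset.mem_biUnion.mp hx
    obtain ⟨j, hjs, hj⟩ := (hmemR e).mp he
    refine Finset.mem_biUnion.mpr ⟨j, hjs, Finset.mem_erase.mpr ⟨hxi, ?_⟩⟩
    simpa [hj, targetPoints] using hxe

/-! ### Evaluation of tropical polynomials -/

variable {T : AddSubgroup ℝ} {I : Finset (ℤ × ℤ)}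

/-- The standard pairing of the exponent plane with the plane of the curve. -/
def pairing (x p : ℝ × ℝ) : ℝ := x.1 * p.1 + x.2 * p.2

theorem monomialValue_eq (a : I → T) (i : I) (p : ℝ × ℝ) :
    monomialValue a i p = (a i : ℝ) + pairing (realPt i) p :=
  add_assoc _ _ _

theorem pairing_add_right (x p p' : ℝ × ℝ) : pairing x (p + p') = pairing x p + pairing x p' := by
  simp only [pairing, Prod.fst_add, Prod.snd_add]; ring

theorem pairing_smul_right (x p : ℝ × ℝ) (t : ℝ) : pairing x (t • p) = t * pairing x p := by
  simp only [pairing, Prod.smul_fst, Prod.smul_snd, smul_eq_mul]; ring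

theorem isLinearMap_pairing_left (p : ℝ × ℝ) : IsLinearMap ℝ fun x => pairing x p where
  map_add x y := by simp only [pairing, Prod.fst_add, Prod.snd_add]; ring
  map_smul t x := by simp only [pairing, Prod.smul_fst, Prod.smul_snd, smul_eq_mul]; ring

theorem realPt_injective : Function.Injective realPt := by
  rintro ⟨x, y⟩ ⟨x', y'⟩ h
  simpa [realPt] using h

/-- The value at `p` of the tropical polynomial with coefficients `a`. -/
noncomputable def tropEval (a : I → T) (p : ℝ × ℝ) : ℝ := ⨆ i, monomialValue a i p

theorem monomialValue_le_tropEval (a : I → T) (i : I) (p : ℝ × ℝ) :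
    monomialValue a i p ≤ tropEval a p :=
  le_ciSup (f := fun i => monomialValue a i p) (Set.finite_range _).bddAbove i

theorem exists_monomialValue_eq_tropEval [Nonempty I] (a : I → T) (p : ℝ × ℝ) :
    ∃ i, monomialValue a i p = tropEval a p :=
  exists_eq_ciSup_of_finite

theorem mem_maxIndices_iff [Nonempty I] {a : I → T} {p : ℝ × ℝ} {i : I} :
    i ∈ maxIndices a p ↔ monomialValue a i p = tropEval a p := by
  refine ⟨fun h => (monomialValue_le_tropEval a i p).antisymm (ciSup_le h), fun h k => ?_⟩
  rw [h]
  exact monomialValue_le_tropEval a k p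

theorem realPt_mem_dualCell {a : I → T} {p : ℝ × ℝ} {i : I} (h : i ∈ maxIndices a p) :
    realPt i ∈ dualCell a p :=
  subset_convexHull ℝ _ ⟨i, h, rfl⟩

theorem isCompact_dualCell (a : I → T) (p : ℝ × ℝ) : IsCompact (dualCell a p) :=
  (Set.toFinite _).isCompact_convexHull ℝ

/-- The points of the dual cell of `p` are subgradients at `p` of the tropical polynomial. -/
theorem tropEval_sub_pairing_le [Nonempty I] {a : I → T} {p x : ℝ × ℝ} (hx : x ∈ dualCell a p)
    (p' : ℝ × ℝ) : tropEval a p - pairing x p ≤ tropEval a p' - pairing x p' := by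
  have hconv : Convex ℝ {y | pairing y (p' - p) ≤ tropEval a p' - tropEval a p} :=
    convex_halfSpace_le (isLinearMap_pairing_left (p' - p)) _
  have hp : ∀ y, pairing y p' = pairing y p + pairing y (p' - p) := fun y => by
    rw [← pairing_add_right, add_sub_cancel]
  have hmem : x ∈ {y | pairing y (p' - p) ≤ tropEval a p' - tropEval a p} := by
    refine convexHull_min ?_ hconv hx
    rintro _ ⟨i, hi, rfl⟩
    have h1 := mem_maxIndices_iff.mp hi
    have h2 := monomialValue_le_tropEval a i p'
    rw [monomialValue_eq] at h1 h2
    have h3 := hp (realPt i)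
    simp only [Set.mem_ofPred_eq]
    linarith
  have h := hp x
  simp only [Set.mem_ofPred_eq] at hmem
  linarith

/-- An interior point of a dual cell lies in no other dual cell. -/
theorem eq_of_mem_interior [Nonempty I] {a : I → T} {p q x : ℝ × ℝ}
    (hx : x ∈ interior (dualCell a q)) (hxp : x ∈ dualCell a p) : p = q := by
  -- The affine function `y ↦ (f p - y · p) - (f q - y · q)` is nonnegative on the dual cell of `q`
  -- and vanishes at `x`, so its linear part vanishes.
  have hzero : ∀ v : ℝ × ℝ, 0 ≤ pairing v (q - p) := by
    intro v
    have hcont : Filter.Tendsto (fun t : ℝ => x + t • v) (nhdsWithin 0 (Set.Ioi 0)) (nhds x) := by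
      have : Continuous fun t : ℝ => x + t • v := by fun_prop
      simpa using (this.tendsto 0).mono_left nhdsWithin_le_nhds
    obtain ⟨t, ht, ht0⟩ := ((hcont.eventually
      (mem_interior_iff_mem_nhds.mp hx)).and self_mem_nhdsWithin).exists
    have ht0 : 0 < t := ht0
    have h1 := tropEval_sub_pairing_le ht p
    have h2 := tropEval_sub_pairing_le hxp q
    have h3 : pairing (x + t • v) q - pairing (x + t • v) p
        = pairing x q - pairing x p + t * pairing v (q - p) := by
      simp only [pairing, Prod.fst_add, Prod.snd_add, Prod.smul_fst, Prod.smul_snd, smul_eq_mul,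
        Prod.fst_sub, Prod.snd_sub]
      ring
    exact nonneg_of_mul_nonneg_right (by linarith) ht0
  have h := hzero (p - q)
  simp only [pairing, Prod.fst_sub, Prod.snd_sub] at h
  have h1 : p.1 - q.1 = 0 := by nlinarith [sq_nonneg (p.1 - q.1), sq_nonneg (p.2 - q.2)]
  have h2 : p.2 - q.2 = 0 := by nlinarith [sq_nonneg (p.1 - q.1), sq_nonneg (p.2 - q.2)]
  exact Prod.ext (sub_eq_zero.mp h1) (sub_eq_zero.mp h2)

/-- The set of points of the curve of `a` is determined by the dual cells. -/
theorem mem_curve_iff {a : I → T} {q : T × T} :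
    q ∈ curve a ↔ (dualCell a (toReal q)).Nontrivial := by
  constructor
  · rintro ⟨i, j, hij, heq, hmax⟩
    refine ⟨realPt i, realPt_mem_dualCell hmax, realPt j, realPt_mem_dualCell fun k => ?_, ?_⟩
    · rw [← heq]; exact hmax k
    · exact fun h => hij (Subtype.ext (realPt_injective h))
  · intro h
    have hnt : (maxIndices a (toReal q)).Nontrivial := by
      by_contra hsub
      rw [Set.not_nontrivial_iff] at hsub
      refine Set.not_nontrivial_iff.mpr ?_ h
      rcases hsub.eq_empty_or_singleton with h0 | ⟨i, hi⟩
      · simp [dualCell, h0]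
      · simp [dualCell, hi]
    obtain ⟨i, hi, j, hj, hij⟩ := hnt
    exact ⟨i, j, hij, (hj i).antisymm (hi j), hi⟩

/-! ### The upper hull of the coefficients -/

/-- The height over the exponent `i` of the upper hull of the lifted points `(k, a k)`, as the value
of the Legendre transform of the tropical polynomial. -/
noncomputable def upperHull (a : I → T) (i : I) : ℝ :=
  ⨅ p : ℝ × ℝ, (tropEval a p - pairing (realPt i) p)

theorem coe_le_tropEval_sub_pairing (a : I → T) (i : I) (p : ℝ × ℝ) :
    (a i : ℝ) ≤ tropEval a p - pairing (realPt i) p := by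
  have h := monomialValue_le_tropEval a i p
  rw [monomialValue_eq] at h
  linarith

theorem coe_le_upperHull (a : I → T) (i : I) : (a i : ℝ) ≤ upperHull a i :=
  le_ciInf (coe_le_tropEval_sub_pairing a i)

theorem upperHull_le (a : I → T) (i : I) (p : ℝ × ℝ) :
    upperHull a i ≤ tropEval a p - pairing (realPt i) p :=
  ciInf_le (f := fun p => tropEval a p - pairing (realPt i) p)
    ⟨a i, by rintro _ ⟨p, rfl⟩; exact coe_le_tropEval_sub_pairing a i p⟩ p

/-- A continuous linear functional on the plane is the pairing with a vector. -/
theorem exists_pairing_eq (g : StrongDual ℝ (ℝ × ℝ)) : ∃ v, ∀ x, g x = pairing x v := by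
  refine ⟨(g (1, 0), g (0, 1)), fun x => ?_⟩
  have hx : x = x.1 • ((1 : ℝ), (0 : ℝ)) + x.2 • ((0 : ℝ), (1 : ℝ)) := by ext <;> simp
  conv_lhs => rw [hx]
  simp only [map_add, map_smul, smul_eq_mul, pairing]

/-- If `x` is not in the dual cell of `p`, moving `p` in a direction that separates `x` from the
cell decreases `f p - x · p`. -/
theorem exists_tropEval_sub_pairing_lt [Nonempty I] {a : I → T} {p x : ℝ × ℝ}
    (hx : x ∉ dualCell a p) : ∃ p', tropEval a p' - pairing x p' < tropEval a p - pairing x p := by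
  obtain ⟨g, u, hgx, hg⟩ := geometric_hahn_banach_point_closed (convex_convexHull ℝ _)
    (isCompact_dualCell a p).isClosed hx
  obtain ⟨v, hv⟩ := exists_pairing_eq (-g)
  have hval : ∀ (k : I) (t : ℝ),
      monomialValue a k (p + t • v) = monomialValue a k p + t * pairing (realPt k) v := by
    intro k t
    rw [monomialValue_eq, monomialValue_eq, pairing_add_right, pairing_smul_right, add_assoc]
  -- Monomials of index in the cell grow more slowly along `v` than the pairing with `x`; the other
  -- ones stay below by continuity.
  have hev : ∀ᶠ t in nhdsWithin (0 : ℝ) (Set.Ioi 0), ∀ k : I,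
      monomialValue a k (p + t • v) < tropEval a p + t * pairing x v := by
    rw [Filter.eventually_all]
    intro k
    by_cases hk : k ∈ maxIndices a p
    · filter_upwards [self_mem_nhdsWithin] with t ht
      have hlt : pairing (realPt k) v < pairing x v := by
        have := hg _ (realPt_mem_dualCell hk)
        rw [← hv, ← hv]
        simp only [neg_apply]
        linarith
      rw [hval, mem_maxIndices_iff.mp hk]
      have := mul_lt_mul_of_pos_left hlt ht
      linarith
    · have hlt : monomialValue a k p < tropEval a p :=
        lt_of_le_of_ne (monomialValue_le_tropEval a k p) fun h => hk (mem_maxIndices_iff.mpr h)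
      simp only [hval]
      refine Filter.Eventually.filter_mono nhdsWithin_le_nhds ?_
      refine ContinuousAt.eventually_lt (by fun_prop) (by fun_prop) ?_
      simpa using hlt
  obtain ⟨t, ht⟩ := hev.exists
  obtain ⟨k, hk⟩ := exists_monomialValue_eq_tropEval a (p + t • v)
  refine ⟨p + t • v, ?_⟩
  have := ht k
  rw [pairing_add_right, pairing_smul_right]
  linarith

theorem upperHull_eq_iff [Nonempty I] {a : I → T} {i : I} {p : ℝ × ℝ} :
    upperHull a i = tropEval a p - pairing (realPt i) p ↔ realPt i ∈ dualCell a p := by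
  refine ⟨fun h => ?_, fun h => (upperHull_le a i p).antisymm ?_⟩
  · by_contra hi
    obtain ⟨p', hp'⟩ := exists_tropEval_sub_pairing_lt hi
    have := upperHull_le a i p'
    linarith
  · exact le_ciInf (tropEval_sub_pairing_le h)

/-- A polynomial whose coefficients lie below the upper hull of those of `a`, up to a constant, and
on it at all extreme points of dual cells of `a`, has the same dual cells as `a`. -/
theorem dualCell_eq_of_le_upperHull [Nonempty I] {a b : I → T} {c : ℝ}
    (hle : ∀ i, (b i : ℝ) ≤ upperHull a i + c)
    (heq : ∀ (i : I) p, realPt i ∈ (dualCell a p).extremePoints ℝ → (b i : ℝ) = upperHull a i + c)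
    (p : ℝ × ℝ) : dualCell a p = dualCell b p := by
  have hval_le : ∀ k, monomialValue b k p ≤ tropEval a p + c := by
    intro k
    have h1 := hle k
    have h2 := upperHull_le a k p
    rw [monomialValue_eq]
    linarith
  have hext : ∀ x ∈ (dualCell a p).extremePoints ℝ,
      ∃ i : I, realPt i = x ∧ monomialValue b i p = tropEval a p + c := by
    intro x hx
    obtain ⟨i, hi, rfl⟩ := extremePoints_convexHull_subset hx
    refine ⟨i, rfl, ?_⟩
    have h := upperHull_eq_iff.mpr (realPt_mem_dualCell hi)
    rw [monomialValue_eq, heq i p hx, h]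
    ring
  have hmax : ∀ i : I, monomialValue b i p = tropEval a p + c → i ∈ maxIndices b p :=
    fun i hi k => hi ▸ hval_le k
  have hne : (dualCell a p).Nonempty := by
    obtain ⟨i, hi⟩ := exists_monomialValue_eq_tropEval a p
    exact ⟨_, realPt_mem_dualCell (mem_maxIndices_iff.mpr hi)⟩
  apply Set.Subset.antisymm
  · rw [← closure_convexHull_extremePoints (isCompact_dualCell a p) (convex_convexHull ℝ _)]
    refine closure_minimal (convexHull_min ?_ (convex_convexHull ℝ _))
      (isCompact_dualCell b p).isClosed
    intro x hx
    obtain ⟨i, rfl, hi⟩ := hext x hx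
    exact realPt_mem_dualCell (hmax i hi)
  · refine convexHull_min ?_ (convex_convexHull ℝ _)
    rintro _ ⟨i, hi, rfl⟩
    obtain ⟨x, hx⟩ := (isCompact_dualCell a p).extremePoints_nonempty hne
    obtain ⟨k, -, hk⟩ := hext x hx
    have h1 := hi k
    have h2 := hle i
    have h3 := upperHull_le a i p
    rw [hk, monomialValue_eq] at h1
    exact upperHull_eq_iff.mp (by linarith)

/-! ### The Cramer coefficients -/

theorem coe_pointMatrix {n : ℕ} (q : Fin n → T × T) (j : Fin n) (i : I) :
    ((pointMatrix I q j i : T) : ℝ) = pairing (realPt i) (toReal (q j)) := by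
  simp [pointMatrix, pairing, realPt, toReal]

theorem coe_sum_pointMatrix {n : ℕ} (q : Fin n → T × T) (g : Fin n → I) :
    ((∑ j, pointMatrix I q j (g j) : T) : ℝ) = ∑ j, pairing (realPt (g j)) (toReal (q j)) := by
  rw [AddSubgroup.val_finsetSum]
  exact Finset.sum_congr rfl fun j _ => coe_pointMatrix q j (g j)

/-- The constant by which the Cramer coefficients are shifted against the upper hull. -/
noncomputable def cramerShift (a : I → T) (q : Fin (I.card - 1) → T × T) : ℝ :=
  ∑ j, tropEval a (toReal (q j)) - ∑ k, upperHull a k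

theorem sum_tropEval_sub_upperHull (a : I → T) (q : Fin (I.card - 1) → T × T) (i : I)
    (σ : Fin (I.card - 1) ≃ {k : I // k ≠ i}) :
    ∑ j, (tropEval a (toReal (q j)) - upperHull a (σ j)) = upperHull a i + cramerShift a q := by
  have h1 : ∑ j, upperHull a (σ j) = ∑ k : {k : I // k ≠ i}, upperHull a k :=
    σ.sum_comp fun k => upperHull a k
  have h2 : ∑ k, upperHull a k = upperHull a i + ∑ k : {k : I // k ≠ i}, upperHull a k :=
    Fintype.sum_eq_add_sum_subtype_ne _ i
  rw [Finset.sum_sub_distrib, cramerShift, h1, h2]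
  ring

theorem stableCoeff_le (a : I → T) (q : Fin (I.card - 1) → T × T) (i : I) :
    (stableCoeff I q i : ℝ) ≤ upperHull a i + cramerShift a q := by
  obtain ⟨σ, -, hσ⟩ := Finset.exists_mem_eq_sup' (Finset.univ_nonempty)
    fun σ : Fin (I.card - 1) ≃ {k : I // k ≠ i} => ∑ j, pointMatrix I q j (σ j)
  have hval : (stableCoeff I q i : ℝ) = ∑ j, pairing (realPt (σ j : I)) (toReal (q j)) := by
    rw [← coe_sum_pointMatrix, ← hσ]
    rfl
  rw [hval, ← sum_tropEval_sub_upperHull a q i σ]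
  refine Finset.sum_le_sum fun j _ => ?_
  have := upperHull_le a (σ j) (toReal (q j))
  linarith

theorem stableCoeff_eq [Nonempty I] {a : I → T} {q : Fin (I.card - 1) → T × T} {i : I}
    (σ : Fin (I.card - 1) ≃ {k : I // k ≠ i})
    (hσ : ∀ j, realPt (σ j : I) ∈ dualCell a (toReal (q j))) :
    (stableCoeff I q i : ℝ) = upperHull a i + cramerShift a q := by
  refine (stableCoeff_le a q i).antisymm ?_
  have hle : ∑ j, pointMatrix I q j (σ j) ≤ stableCoeff I q i :=
    Finset.le_sup' (fun σ : Fin (I.card - 1) ≃ {k : I // k ≠ i} => ∑ j, pointMatrix I q j (σ j))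
      (Finset.mem_univ σ)
  have hle' : ((∑ j, pointMatrix I q j (σ j) : T) : ℝ) ≤ stableCoeff I q i := hle
  rw [coe_sum_pointMatrix] at hle'
  rw [← sum_tropEval_sub_upperHull a q i σ]
  refine le_trans (Finset.sum_le_sum fun j _ => ?_) hle'
  rw [upperHull_eq_iff.mpr (hσ j)]
  linarith

/-! ### Assignments -/

variable {a : I → T} {q : T × T}

/-- Every point of `I` to which a point `q` can be matched lies in the dual cell of `q`. -/
theorem IsAssignable.realPt_mem_dualCell {z : I ⊕ Sym2 I} (h : IsAssignable a q z) {k : I}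
    (hk : k ∈ targetPoints z) : realPt k ∈ dualCell a (toReal q) := by
  have hends : ∀ x y : I, segment ℝ (realPt x) (realPt y) ⊆ dualCell a (toReal q) →
      k ∈ targetPoints (Sum.inr s(x, y)) → realPt k ∈ dualCell a (toReal q) := by
    intro x y hsub hk
    have hk : k = x ∨ k = y := by simpa [targetPoints] using hk
    rcases hk with rfl | rfl
    · exact hsub (left_mem_segment ℝ _ _)
    · exact hsub (right_mem_segment ℝ _ _)
  cases h with
  | edge x y _ _ hsub => exact hends x y hsub hk
  | vertexPoint x _ hx =>
    obtain rfl : k = x := by simpa [targetPoints] using hk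
    exact interior_subset hx
  | vertexEdge x y _ _ hsub =>
    exact hends x y (hsub.trans (isCompact_dualCell a _).isClosed.frontier_subset) hk

theorem IsAssignable.mem_edgeSet {e : Sym2 I} (h : IsAssignable a q (Sum.inr e)) :
    e ∈ (refinedGraph a).edgeSet := by
  cases h with
  | edge x y _ hadj _ => exact hadj
  | vertexEdge x y _ hadj _ => exact hadj

theorem exists_cellDim_eq_one_of_mem_edge {e : Sym2 I} (he : e ∈ (refinedGraph a).edgeSet) {x : I}
    (hx : x ∈ e) : ∃ p, cellDim (dualCell a p) = 1 ∧ realPt x ∈ dualCell a p := by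
  induction e using Sym2.ind with
  | _ y z =>
    obtain ⟨-, ⟨_, ⟨p, rfl⟩, hdim, hy, hz⟩, -⟩ := he
    rcases Sym2.mem_iff.mp hx with rfl | rfl
    · exact ⟨p, hdim, hy⟩
    · exact ⟨p, hdim, hz⟩

/-- A point of `I` in the interior of a polygon of the subdivision is isolated in `Γ`. -/
theorem IsAssignable.notMem_edge [Nonempty I] {x : I} (h : IsAssignable a q (Sum.inl x))
    {e : Sym2 I} (he : e ∈ (refinedGraph a).edgeSet) : x ∉ e := by
  intro hx
  obtain ⟨p, hdim, hxp⟩ := exists_cellDim_eq_one_of_mem_edge he hx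
  cases h with
  | vertexPoint _ hdim' hint =>
    obtain rfl := eq_of_mem_interior hint hxp
    omega

theorem IsAssignable.notMem_extremePoints [Nonempty I] {x : I}
    (h : IsAssignable a q (Sum.inl x)) (p : ℝ × ℝ) :
    realPt x ∉ (dualCell a p).extremePoints ℝ := by
  intro hx
  cases h with
  | vertexPoint _ _ hint =>
    obtain rfl := eq_of_mem_interior hint (extremePoints_subset hx)
    exact (disjoint_interior_extremePoints _).le_bot ⟨hint, hx⟩

/-- An assignment yields, for every `i` that is not an assigned point, a bijection that attains the
tropical determinant defining the `i`-th Cramer coefficient. -/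
theorem IsAssignment.exists_equiv [Nonempty I] {q : Fin (I.card - 1) → T × T}
    {α : Fin (I.card - 1) → I ⊕ Sym2 I} (h : IsAssignment a q α) {i : I}
    (hi : ∀ j, α j ≠ Sum.inl i) :
    ∃ σ : Fin (I.card - 1) ≃ {k : I // k ≠ i},
      ∀ j, realPt (σ j : I) ∈ dualCell a (toReal (q j)) := by
  obtain ⟨f, hf, hmem⟩ := exists_injective_avoiding h.injective
    (fun j e hj => (refinedGraph a).not_isDiag_of_mem_edgeSet (hj ▸ h.assignable j).mem_edgeSet)
    h.acyclic
    (fun j k x e hj hk => (hj ▸ h.assignable j : IsAssignable a (q j) (Sum.inl x)).notMem_edge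
      (hk ▸ h.assignable k : IsAssignable a (q k) (Sum.inr e)).mem_edgeSet) hi
  let g : Fin (I.card - 1) → {k : I // k ≠ i} := fun j => ⟨f j, (hmem j).2⟩
  have hg : Function.Injective g := fun j k hjk => hf (congrArg Subtype.val hjk)
  have hcard := Fintype.card_congr (Classical.choice (nonempty_equiv_ne I i))
  refine ⟨Equiv.ofBijective g ((Fintype.bijective_iff_injective_and_card g).mpr ⟨hg, hcard⟩),
    fun j => ?_⟩
  exact (h.assignable j).realPt_mem_dualCell (hmem j).1

/-- A curve is the stable curve through any points that have an assignment. -/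
theorem IsAssignment.isStableCurve [Nonempty I] {q : Fin (I.card - 1) → T × T}
    {α : Fin (I.card - 1) → I ⊕ Sym2 I} (h : IsAssignment a q α) : IsStableCurve a q := by
  have hcell : ∀ p, dualCell a p = dualCell (stableCoeff I q) p := by
    refine dualCell_eq_of_le_upperHull (stableCoeff_le a q) fun (i : I) p hip => ?_
    obtain ⟨σ, hσ⟩ := h.exists_equiv (i := i) fun j hj =>
      (hj ▸ h.assignable j : IsAssignable a (q j) (Sum.inl i)).notMem_extremePoints p hip
    exact stableCoeff_eq σ hσ
  refine ⟨Set.ext fun p => ?_, hcell⟩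
  rw [mem_curve_iff, mem_curve_iff, hcell]

end TropPlane

theorem mainTheorem8
    (T : AddSubgroup ℝ) (hT : T ≠ ⊥)
    (hdiv : ∀ n : ℕ, n ≠ 0 → ∀ x ∈ T, ∃ y ∈ T, n • y = x)
    (I : Finset (ℤ × ℤ)) (hI : I.Nonempty)
    (a : I → T)
    (q : Fin (I.card - 1) → T × T)
    (hq : ∀ j, q j ∈ TropPlane.curve a)
    (hassign : ∃ α : Fin (I.card - 1) → I ⊕ Sym2 I, TropPlane.IsAssignment a q α) :
    TropPlane.IsStableCurve a q ∧ TropPlane.InGeneralPosition a q := by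
  have : Nonempty I := hI.to_subtype
  obtain ⟨α, hα⟩ := hassign
  exact ⟨hα.isStableCurve, le_rfl, q, fun _ => rfl, hα.isStableCurve⟩
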